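/- Let $\Theta$ be a compact metric space, let $r:\Theta\to\Theta$ be a continuous map which is uniquely ergodic (there is exactly one $r$-invariant Borel probability measure on $\Theta$), and let $\mathbb{T}^1=\mathbb{R}/\mathbb{Z}$. Let $f:\Theta\times\mathbb{T}^1\to\Theta\times\mathbb{T}^1$ be a continuous map of the form $f(\theta,\varphi)=(r(\theta),f_\theta(\varphi))$ which is homotopic to the map $(\theta,\varphi)\mapsto(r(\theta),\varphi)$. Let $F:\Theta\times\mathbb{R}\to\Theta\times\mathbb{R}$ be a continuous lift of $f$, that is, $\pi\circ F=f\circ\pi$ for the natural projection $\pi:\Theta\times\mathbb{R}\to\Theta\times\mathbb{T}^1$; write $F^n(\theta,x)=(r^n(\theta),F^n_\theta(x))$ for its iterates. If the fibred rotation interval $$\rho_{\mathrm{fib}}(F)=\Big\{\limsup_{n\to\infty}\tfrac1n\big(F^n_\theta(x)-x\big)\ \Big|\ (\theta,x)\in\Theta\times\mathbb{R}\Big\}\subseteq\mathbb{R}$$ has non-empty interior, then the topological entropy of $f$ is strictly positive: $h_{\mathrm{top}}(f)>0$. -/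

import Mathlib

open Filter Topology MeasureTheory

/-- A continuous self-map `r` of a compact metric space is uniquely ergodic if there is exactly one
`r`-invariant Borel probability measure. -/
def IsUniquelyErgodic {Θ : Type*} [MeasurableSpace Θ] (r : Θ → Θ) : Prop :=
  ∃! μ : Measure Θ, IsProbabilityMeasure μ ∧ MeasurePreserving r μ μ

/-- `f` is a skew product over the base map `r`, i.e. `f (θ, φ) = (r θ, f_θ φ)`. As `f` is
continuous, this is an `r`-forced circle endomorphism. -/
def IsForcedCircleMap {Θ : Type*} [TopologicalSpace Θ] (r : C(Θ, Θ))
    (f : C(Θ × UnitAddCircle, Θ × UnitAddCircle)) : Prop :=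
  ∀ (θ : Θ) (φ : UnitAddCircle), (f (θ, φ)).1 = r θ

/-- `f` is "homotopic to the identity": it is homotopic, as a continuous self-map of
`Θ × ℝ/ℤ`, to the map `(θ, φ) ↦ (r θ, φ)`. -/
def IsHomotopicToIdentity {Θ : Type*} [TopologicalSpace Θ] (r : C(Θ, Θ))
    (f : C(Θ × UnitAddCircle, Θ × UnitAddCircle)) : Prop :=
  ContinuousMap.Homotopic f (r.prodMap (ContinuousMap.id UnitAddCircle))

/-- The natural projection `Θ × ℝ → Θ × ℝ/ℤ`. -/
def circleProj {Θ : Type*} (p : Θ × ℝ) : Θ × UnitAddCircle :=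
  (p.1, (p.2 : UnitAddCircle))

/-- The continuous map `F : Θ × ℝ → Θ × ℝ` is a lift of `f`: `π ∘ F = f ∘ π`. -/
def IsCircleLift {Θ : Type*} [TopologicalSpace Θ] (F : C(Θ × ℝ, Θ × ℝ))
    (f : C(Θ × UnitAddCircle, Θ × UnitAddCircle)) : Prop :=
  ∀ p : Θ × ℝ, circleProj (F p) = f (circleProj p)

/-- The fibred rotation interval of a lift `F`: all numbers
`limsup_{n → ∞} (F_θ^n x - x) / n` with `(θ, x) ∈ Θ × ℝ`. Here `F_θ^n x` is the second
coordinate of `F^n (θ, x)`. -/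
noncomputable def fibredRotationInterval {Θ : Type*} (F : Θ × ℝ → Θ × ℝ) : Set ℝ :=
  Set.range fun p : Θ × ℝ =>
    limsup (fun n : ℕ => (1 / (n : ℝ)) * ((F^[n] p).2 - p.2)) atTop

/-- Topological entropy (Bowen's definition by covers with dynamical balls, on the whole space). -/
noncomputable def topEntropy {X : Type*} [UniformSpace X] (f : X → X) : EReal :=
  Dynamics.coverEntropy f Set.univ

/-!
Let `M` and `m` be the largest and the smallest displacement of `F^N` over a base point. A number
of the fibred rotation interval is at most `1/N` times the average of `M` along the orbit of `r`,
and at least `1/N` times that of `m`. By unique ergodicity these averages do not depend on the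
orbit, so two numbers `a < b` of the interval force the oscillation `M - m` to have average at
least `N (b - a)` along *every* orbit of `r`, which exceeds `5` for large `N`. As `r^N` need not be
uniquely ergodic, this is passed to orbits of `r^N` by picking, for each length, one of the `N`
residue classes.

Over a base point where `M - m ≥ 5`, the map `F^N` stretches a fundamental domain over an interval
of length `4`. Its fibre then contains two pieces, uniformly far apart because their images lie at
distance at least `2`, each mapped onto the whole next fibre. Pulling back through these fibrewise
horseshoes doubles the number of separated points at each such visit, and visits have positive
frequency because `M - m` is bounded.
-/

section BirkhoffSum

variable {α β M : Type*} [AddCommMonoid M]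

theorem birkhoffSum_birkhoffSum (f : α → α) (g : α → M) (m n : ℕ) (x : α) :
    birkhoffSum f (birkhoffSum f g m) n x =
      ∑ i ∈ Finset.range m, birkhoffSum f g n (f^[i] x) := by
  simp only [birkhoffSum, ← Function.iterate_add_apply]
  rw [Finset.sum_comm]
  simp only [add_comm]

theorem birkhoffSum_mul_eq_sum_iterate (f : α → α) (g : α → M) (m n : ℕ) (x : α) :
    birkhoffSum f g (m * n) x = ∑ i ∈ Finset.range m, birkhoffSum f^[m] g n (f^[i] x) := by
  induction n with
  | zero => simp
  | succ n ih =>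
    rw [Nat.mul_succ, birkhoffSum_add, ih]
    simp only [birkhoffSum_succ, Finset.sum_add_distrib]
    congr 1
    simp only [birkhoffSum, ← Function.iterate_mul, ← Function.iterate_add_apply, add_comm]

theorem birkhoffSum_comp_of_semiconj {π : α → β} {f : α → α} {f' : β → β}
    (h : Function.Semiconj π f f') (g : β → M) (n : ℕ) (x : α) :
    birkhoffSum f (g ∘ π) n x = birkhoffSum f' g n (π x) :=
  Finset.sum_congr rfl fun k _ => congrArg g ((h.iterate_right k).eq x)

theorem birkhoffAverage_birkhoffSum (R : Type*) [DivisionSemiring R] [Module R M]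
    (f : α → α) (g : α → M) (m n : ℕ) (x : α) :
    birkhoffAverage R f (birkhoffSum f g m) n x =
      ∑ i ∈ Finset.range m, birkhoffAverage R f g n (f^[i] x) := by
  simp only [birkhoffAverage, birkhoffSum_birkhoffSum, Finset.smul_sum]

theorem birkhoffAverage_comp_of_semiconj (R : Type*) [DivisionSemiring R] [Module R M]
    {π : α → β} {f : α → α} {f' : β → β} (h : Function.Semiconj π f f') (g : β → M) (n : ℕ)
    (x : α) : birkhoffAverage R f (g ∘ π) n x = birkhoffAverage R f' g n (π x) :=
  congrArg _ (birkhoffSum_comp_of_semiconj h g n x)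

theorem birkhoffAverage_mono {f : α → α} {g h : α → ℝ} (hgh : g ≤ h) (n : ℕ) (x : α) :
    birkhoffAverage ℝ f g n x ≤ birkhoffAverage ℝ f h n x :=
  smul_le_smul_of_nonneg_left (Finset.sum_le_sum fun _ _ => hgh _) (by positivity)

/- Splitting an orbit of `f` into the `m` orbits of `f^[m]` it consists of, one of them has at
least the average of the whole. -/
theorem exists_mul_le_birkhoffSum_iterate {f : α → α} {g : α → ℝ} {c : ℝ} {m n : ℕ} (hm : 0 < m)
    {x : α} (h : c ≤ birkhoffAverage ℝ f g (m * n) x) :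
    ∃ y, c * n ≤ birkhoffSum f^[m] g n y := by
  obtain rfl | hn := n.eq_zero_or_pos
  · exact ⟨x, by simp⟩
  have hsum : ∑ _i ∈ Finset.range m, c * n ≤
      ∑ i ∈ Finset.range m, birkhoffSum f^[m] g n (f^[i] x) := by
    rw [birkhoffAverage, smul_eq_mul, le_inv_mul_iff₀ (by positivity)] at h
    rw [← birkhoffSum_mul_eq_sum_iterate, Finset.sum_const, Finset.card_range, nsmul_eq_mul]
    push_cast at h
    linarith
  obtain ⟨i, -, hi⟩ := Finset.exists_le_of_sum_le (Finset.nonempty_range_iff.2 hm.ne') hsum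
  exact ⟨f^[i] x, hi⟩

end BirkhoffSum

section BoundedBirkhoffAverage

variable {α E : Type*} [NormedAddCommGroup E] [NormedSpace ℝ E]

theorem tendsto_birkhoffAverage_iterate_sub_birkhoffAverage {g : α → E}
    (hg : Bornology.IsBounded (Set.range g)) (f : α → α) (k : ℕ) (x : α) :
    Tendsto (fun n => birkhoffAverage ℝ f g n (f^[k] x) - birkhoffAverage ℝ f g n x)
      atTop (𝓝 0) := by
  induction k with
  | zero => simp
  | succ k ih =>
    have hstep := (tendsto_birkhoffAverage_apply_sub_birkhoffAverage' ℝ hg f (f^[k] x)).add ih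
    simpa only [Function.iterate_succ_apply', sub_add_sub_cancel, add_zero] using hstep

theorem tendsto_birkhoffAverage_birkhoffSum_sub_smul {g : α → E}
    (hg : Bornology.IsBounded (Set.range g)) (f : α → α) (m : ℕ) (x : α) :
    Tendsto (fun n => birkhoffAverage ℝ f (birkhoffSum f g m) n x -
      m • birkhoffAverage ℝ f g n x) atTop (𝓝 0) := by
  have hsum := tendsto_finsetSum (Finset.range m) fun k _ =>
    tendsto_birkhoffAverage_iterate_sub_birkhoffAverage hg f k x
  simpa only [birkhoffAverage_birkhoffSum, Finset.sum_sub_distrib, Finset.sum_const,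
    Finset.card_range, smul_zero] using hsum

theorem exists_forall_norm_birkhoffAverage_le {g : α → E}
    (hg : Bornology.IsBounded (Set.range g)) (f : α → α) :
    ∃ C, ∀ n x, ‖birkhoffAverage ℝ f g n x‖ ≤ C := by
  obtain ⟨C, hC⟩ := hg.exists_norm_le
  refine ⟨max C 0, fun n x => ?_⟩
  obtain rfl | hn := n.eq_zero_or_pos
  · simp
  have hsum : ‖birkhoffSum f g n x‖ ≤ n * C := by
    simpa [birkhoffSum] using norm_sum_le_of_le (Finset.range n) fun k _ => hC _ ⟨f^[k] x, rfl⟩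
  rw [birkhoffAverage, norm_smul, norm_inv, RCLike.norm_natCast,
    inv_mul_le_iff₀ (by positivity)]
  exact hsum.trans (by gcongr; exact le_max_left _ _)

variable {f : α → α} {g h : α → ℝ} {m : ℕ} {x : α} {c : ℝ}

theorem limsup_birkhoffAverage_le_div (hg : Bornology.IsBounded (Set.range g)) (hm : 0 < m)
    (hgh : birkhoffSum f g m ≤ h)
    (hc : Tendsto (fun n => birkhoffAverage ℝ f h n x) atTop (𝓝 c)) :
    limsup (fun n => birkhoffAverage ℝ f g n x) atTop ≤ c / m := by
  have hm' : (0 : ℝ) < m := by exact_mod_cast hm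
  obtain ⟨C, hC⟩ := exists_forall_norm_birkhoffAverage_le hg f
  have hlim := (hc.sub (tendsto_birkhoffAverage_birkhoffSum_sub_smul hg f m x)).div_const (m : ℝ)
  rw [sub_zero] at hlim
  rw [← hlim.limsup_eq]
  refine limsup_le_limsup (.of_forall fun n => ?_) ?_ hlim.isBoundedUnder_le
  · have hle := birkhoffAverage_mono (f := f) hgh n x
    simp only [nsmul_eq_mul, le_div_iff₀ hm']
    linarith
  · exact (isBoundedUnder_of ⟨-C, fun n => (abs_le.1 (hC n x)).1⟩ :
      IsBoundedUnder (· ≥ ·) atTop _).isCoboundedUnder_le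

theorem div_le_limsup_birkhoffAverage (hg : Bornology.IsBounded (Set.range g)) (hm : 0 < m)
    (hgh : h ≤ birkhoffSum f g m)
    (hc : Tendsto (fun n => birkhoffAverage ℝ f h n x) atTop (𝓝 c)) :
    c / m ≤ limsup (fun n => birkhoffAverage ℝ f g n x) atTop := by
  have hm' : (0 : ℝ) < m := by exact_mod_cast hm
  obtain ⟨C, hC⟩ := exists_forall_norm_birkhoffAverage_le hg f
  have hlim := (hc.sub (tendsto_birkhoffAverage_birkhoffSum_sub_smul hg f m x)).div_const (m : ℝ)
  rw [sub_zero] at hlim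
  rw [← hlim.limsup_eq]
  refine limsup_le_limsup (.of_forall fun n => ?_) hlim.isCoboundedUnder_le
    (isBoundedUnder_of ⟨C, fun n => (abs_le.1 (hC n x)).2⟩)
  have hle := birkhoffAverage_mono (f := f) hgh n x
  simp only [nsmul_eq_mul, div_le_iff₀ hm']
  linarith

end BoundedBirkhoffAverage

section VisitCount

variable {α : Type*}

/-- The number of visits to `P` of the orbit segment `x, f x, …, f^[n - 1] x`, encoded as a Birkhoff
sum of an indicator function. -/
noncomputable def visitCount (f : α → α) (P : Set α) (n : ℕ) (x : α) : ℕ :=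
  birkhoffSum f (P.indicator 1) n x

theorem visitCount_succ_of_mem {f : α → α} {P : Set α} {x : α} (hx : x ∈ P) (n : ℕ) :
    visitCount f P (n + 1) x = visitCount f P n (f x) + 1 := by
  rw [visitCount, birkhoffSum_succ', Set.indicator_of_mem hx, Pi.one_apply, add_comm, visitCount]

theorem visitCount_succ_of_notMem {f : α → α} {P : Set α} {x : α} (hx : x ∉ P) (n : ℕ) :
    visitCount f P (n + 1) x = visitCount f P n (f x) := by
  rw [visitCount, birkhoffSum_succ', Set.indicator_of_notMem hx, zero_add, visitCount]

theorem birkhoffSum_le_mul_add_mul_visitCount {g : α → ℝ} {P : Set α} {a M : ℝ}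
    (ha : ∀ x ∉ P, g x ≤ a) (hM : ∀ x ∈ P, g x ≤ a + M) (f : α → α) (n : ℕ) (x : α) :
    birkhoffSum f g n x ≤ a * n + M * visitCount f P n x := by
  induction n generalizing x with
  | zero => simp [visitCount]
  | succ n ih =>
    rw [birkhoffSum_succ']
    by_cases hx : x ∈ P
    · rw [visitCount_succ_of_mem hx]
      push_cast
      linarith [hM x hx, ih (f x)]
    · rw [visitCount_succ_of_notMem hx]
      push_cast
      linarith [ha x hx, ih (f x)]

end VisitCount

section UniqueErgodicity

variable {Θ : Type*} [MeasurableSpace Θ]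

/-- The uniform distribution on the orbit segment `θ, r θ, …, r^[n] θ`. The segment has `n + 1`
points, so that this is a probability measure for every `n`. -/
noncomputable def empiricalMeasure (r : Θ → Θ) (θ : Θ) (n : ℕ) : ProbabilityMeasure Θ :=
  ⟨((n + 1 : ℕ) : ENNReal)⁻¹ • ∑ k ∈ Finset.range (n + 1), Measure.dirac (r^[k] θ), ⟨by
    simp only [Measure.smul_apply, Measure.finsetSum_apply, measure_univ, Finset.sum_const,
      Finset.card_range, smul_eq_mul, nsmul_eq_mul, mul_one]
    exact ENNReal.inv_mul_cancel (by simp) (ENNReal.natCast_ne_top _)⟩⟩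

variable [TopologicalSpace Θ] [BorelSpace Θ]

theorem integral_empiricalMeasure (r : Θ → Θ) (θ : Θ) (n : ℕ)
    (g : BoundedContinuousFunction Θ ℝ) :
    ∫ x, g x ∂(empiricalMeasure r θ n : Measure Θ) = birkhoffAverage ℝ r g (n + 1) θ := by
  have hint : ∀ k ∈ Finset.range (n + 1), Integrable g (Measure.dirac (r^[k] θ)) :=
    fun k _ => g.integrable _
  simp only [empiricalMeasure, ProbabilityMeasure.coe_mk, integral_smul_measure,
    integral_finsetSum_measure hint, integral_dirac' _ _ g.continuous.stronglyMeasurable,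
    ENNReal.toReal_inv, ENNReal.toReal_natCast, birkhoffAverage, birkhoffSum]

theorem tendsto_birkhoffAverage_of_tendsto_empiricalMeasure {r : Θ → Θ} {θ : Θ} {l : Filter ℕ}
    {ν : ProbabilityMeasure Θ} (hν : Tendsto (empiricalMeasure r θ) l (𝓝 ν))
    (g : BoundedContinuousFunction Θ ℝ) :
    Tendsto (fun n => birkhoffAverage ℝ r g (n + 1) θ) l (𝓝 (∫ x, g x ∂(ν : Measure Θ))) := by
  simpa only [integral_empiricalMeasure] using
    ProbabilityMeasure.tendsto_iff_forall_integral_tendsto.1 hν g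

/- Krylov–Bogolyubov: `g ∘ r` and `g` have asymptotically the same averages along an orbit. -/
theorem measurePreserving_of_tendsto_empiricalMeasure [HasOuterApproxClosed Θ] {r : C(Θ, Θ)} {θ : Θ}
    {l : Filter ℕ} [l.NeBot] (hl : l ≤ atTop) {ν : ProbabilityMeasure Θ}
    (hν : Tendsto (empiricalMeasure r θ) l (𝓝 ν)) :
    MeasurePreserving r (ν : Measure Θ) ν := by
  have hr : Measurable r := r.continuous.measurable
  refine ⟨hr, ?_⟩
  have := Measure.isProbabilityMeasure_map (μ := (ν : Measure Θ)) hr.aemeasurable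
  refine ext_of_forall_integral_eq_of_IsFiniteMeasure fun g => ?_
  rw [integral_map hr.aemeasurable g.continuous.aestronglyMeasurable]
  have hdiff := ((tendsto_birkhoffAverage_apply_sub_birkhoffAverage' ℝ g.isBounded_range r θ).comp
    (tendsto_add_atTop_nat 1)).mono_left hl
  have hsum := hdiff.add (tendsto_birkhoffAverage_of_tendsto_empiricalMeasure hν g)
  rw [zero_add] at hsum
  refine tendsto_nhds_unique
    (tendsto_birkhoffAverage_of_tendsto_empiricalMeasure hν (g.compContinuous r))
    (hsum.congr fun n => (sub_add_cancel _ _).trans ?_)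
  exact (birkhoffAverage_comp_of_semiconj ℝ (fun _ => rfl) g (n + 1) θ).symm

variable [CompactSpace Θ] [T2Space Θ] [HasOuterApproxClosed Θ] {r : C(Θ, Θ)}

theorem IsUniquelyErgodic.exists_tendsto_empiricalMeasure (hr : IsUniquelyErgodic r) :
    ∃ μ : ProbabilityMeasure Θ, ∀ θ, Tendsto (empiricalMeasure r θ) atTop (𝓝 μ) := by
  obtain ⟨μ, ⟨hμ, -⟩, huniq⟩ := hr
  refine ⟨⟨μ, hμ⟩, fun θ => tendsto_iff_ultrafilter _ _ _ |>.2 fun U hU => ?_⟩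
  obtain ⟨ν, -, hν⟩ := isCompact_univ.ultrafilter_le_nhds (U.map (empiricalMeasure r θ)) (by simp)
  have hinv := measurePreserving_of_tendsto_empiricalMeasure hU hν
  obtain rfl : ν = ⟨μ, hμ⟩ := Subtype.ext (huniq ν ⟨inferInstance, hinv⟩)
  exact hν

theorem IsUniquelyErgodic.exists_tendsto_birkhoffAverage (hr : IsUniquelyErgodic r) (g : C(Θ, ℝ)) :
    ∃ c : ℝ, ∀ θ, Tendsto (fun n => birkhoffAverage ℝ r g n θ) atTop (𝓝 c) := by
  obtain ⟨μ, hμ⟩ := hr.exists_tendsto_empiricalMeasure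
  exact ⟨∫ x, g x ∂(μ : Measure Θ), fun θ => (tendsto_add_atTop_iff_nat 1).1
    (tendsto_birkhoffAverage_of_tendsto_empiricalMeasure (hμ θ)
      (BoundedContinuousFunction.mkOfCompact g))⟩

end UniqueErgodicity

section Separated

open Dynamics
open scoped Uniformity

variable {X : Type*} {f : X → X} {V : SetRel X X} {n : ℕ}

theorem isSeparated_union {R : SetRel X X} [R.IsSymm] {s t : Set X} (hs : R.IsSeparated s)
    (ht : R.IsSeparated t) (hst : ∀ x ∈ s, ∀ y ∈ t, (x, y) ∉ R) : R.IsSeparated (s ∪ t) :=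
  Set.pairwise_union.2 ⟨hs, ht, fun x hx y hy _ =>
    ⟨hst x hx y hy, fun h => hst x hx y hy (R.symm h)⟩⟩

theorem isSeparated_dynEntourage_of_iterate {N : ℕ} (hN : 0 < N) {s : Set X}
    (hs : (dynEntourage f^[N] V n).IsSeparated s) : (dynEntourage f V (N * n)).IsSeparated s := by
  refine hs.mono_left fun ⟨x, y⟩ hxy => mem_dynEntourage.2 fun k hk => ?_
  simpa only [Function.iterate_mul] using
    mem_dynEntourage.1 hxy (N * k) (Nat.mul_lt_mul_of_pos_left hk hN)

theorem exists_isSeparated_dynEntourage_succ {S : Finset X} {A : Set X} (hSA : ↑S ⊆ f '' A)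
    (hS : (dynEntourage f V n).IsSeparated S) :
    ∃ T : Finset X, ↑T ⊆ A ∧ (dynEntourage f V (n + 1)).IsSeparated T ∧ T.card = S.card := by
  classical
  obtain ⟨T, hTA, hinj, rfl⟩ := Finset.exists_subset_injOn_image_eq_of_surjOn A S hSA
  refine ⟨T, hTA, fun x hx y hy hxy hmem => ?_, (Finset.card_image_of_injOn hinj).symm⟩
  refine hS (Finset.mem_coe.2 (Finset.mem_image_of_mem f hx))
    (Finset.mem_coe.2 (Finset.mem_image_of_mem f hy)) (hinj.ne hx hy hxy) ?_
  exact mem_dynEntourage.2 fun k hk => mem_dynEntourage.1 hmem (k + 1) (Nat.succ_lt_succ hk)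

theorem exists_isSeparated_subset_two_pow_visitCount {Θ : Type*} {R : Θ → Θ} [V.IsRefl] [V.IsSymm]
    {A : Θ → Set X} {P : Set Θ} (hne : ∀ θ, (A θ).Nonempty) (hA : ∀ θ, A (R θ) ⊆ f '' A θ)
    (hP : ∀ θ ∈ P, ∃ B ⊆ A θ, ∃ C ⊆ A θ, (∀ x ∈ B, ∀ y ∈ C, (x, y) ∉ V) ∧
      A (R θ) ⊆ f '' B ∧ A (R θ) ⊆ f '' C) (n : ℕ) (θ : Θ) :
    ∃ S : Finset X, ↑S ⊆ A θ ∧ (dynEntourage f V n).IsSeparated S ∧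
      2 ^ visitCount R P n θ ≤ S.card := by
  classical
  induction n generalizing θ with
  | zero =>
    obtain ⟨x, hx⟩ := hne θ
    exact ⟨{x}, by simpa using hx, by simp, by simp [visitCount]⟩
  | succ n ih =>
    obtain ⟨S, hSA, hS, hcard⟩ := ih (R θ)
    by_cases hθ : θ ∈ P
    · obtain ⟨B, hBA, C, hCA, hBC, hB, hC⟩ := hP θ hθ
      obtain ⟨T, hTB, hT, hTcard⟩ := exists_isSeparated_dynEntourage_succ (hSA.trans hB) hS
      obtain ⟨U, hUC, hU, hUcard⟩ := exists_isSeparated_dynEntourage_succ (hSA.trans hC) hS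
      have hTU : ∀ x ∈ T, ∀ y ∈ U, (x, y) ∉ V := fun x hx y hy => hBC x (hTB hx) y (hUC hy)
      have hdisj : Disjoint T U :=
        Finset.disjoint_left.2 fun x hx hx' => hTU x hx x hx' (SetRel.rfl V)
      refine ⟨T ∪ U, ?_, ?_, ?_⟩
      · rw [Finset.coe_union]
        exact Set.union_subset (hTB.trans hBA) (hUC.trans hCA)
      · rw [Finset.coe_union]
        exact isSeparated_union hT hU fun x hx y hy hxy =>
          hTU x hx y hy (mem_dynEntourage.1 hxy 0 n.succ_pos)
      · rw [visitCount_succ_of_mem hθ, Finset.card_union_of_disjoint hdisj, pow_succ]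
        omega
    · obtain ⟨T, hTA, hT, hTcard⟩ := exists_isSeparated_dynEntourage_succ (hSA.trans (hA θ)) hS
      exact ⟨T, hTA, hT, by rwa [visitCount_succ_of_notMem hθ, hTcard]⟩

variable [UniformSpace X]

theorem le_topEntropy_of_frequently_isSeparated (hV : V ∈ 𝓤 X) {a : ℝ}
    (h : ∃ᶠ n : ℕ in atTop, ∃ S : Finset X,
      (dynEntourage f V n).IsSeparated S ∧ Real.exp (a * n) ≤ S.card) :
    a ≤ topEntropy f := by
  obtain ⟨U, hU, hsymm, hUV⟩ := comp_symm_mem_uniformity_sets hV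
  refine le_trans (Frequently.le_expGrowthSup (h.mono ?_))
    (netEntropyEntourage_le_coverEntropy f Set.univ hU)
  rintro n ⟨S, hS, hcard⟩
  have hnet : IsDynNetIn f Set.univ U n S := by
    refine ⟨Set.subset_univ _, fun x hx y hy hxy => Set.disjoint_iff_inter_eq_empty.2 ?_⟩
    by_contra hball
    exact hS hy hx hxy.symm (dynEntourage_monotone f n hUV
      (mem_ball_dynEntourage_comp f n x y (Set.nonempty_iff_ne_empty.2 hball)))
  calc EReal.exp (a * n) = ENNReal.ofReal (Real.exp (a * n)) := by
        rw [← EReal.exp_coe]; push_cast; rfl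
    _ ≤ ENNReal.ofReal S.card := ENNReal.ofReal_le_ofReal hcard
    _ = ((S.card : ℕ∞) : ENNReal) := by simp
    _ ≤ netMaxcard f Set.univ U n := ENat.toENNReal_mono hnet.card_le_netMaxcard

theorem topEntropy_pos_of_eventually_isSeparated_iterate (hV : V ∈ 𝓤 X) {N : ℕ} (hN : 0 < N)
    {c : ℝ} (hc : 0 < c)
    (h : ∀ᶠ n : ℕ in atTop, ∃ (S : Finset X) (k : ℕ),
      (dynEntourage f^[N] V n).IsSeparated S ∧ 2 ^ k ≤ S.card ∧ c * n ≤ k) :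
    0 < topEntropy f := by
  have ha : 0 < Real.log 2 * c / N :=
    div_pos (mul_pos (Real.log_pos one_lt_two) hc) (by exact_mod_cast hN)
  refine (EReal.coe_pos.2 ha).trans_le (le_topEntropy_of_frequently_isSeparated hV ?_)
  refine (tendsto_id.const_mul_atTop' hN).frequently (h.mono ?_).frequently
  rintro n ⟨S, k, hS, hcard, hk⟩
  refine ⟨S, isSeparated_dynEntourage_of_iterate hN hS, ?_⟩
  calc Real.exp (Real.log 2 * c / N * (N * n : ℕ)) = Real.exp (Real.log 2 * (c * n)) := by
        push_cast; field_simp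
    _ ≤ Real.exp (Real.log 2 * k) := by gcongr
    _ = 2 ^ k := by rw [Real.exp_mul, Real.exp_log two_pos, Real.rpow_natCast]
    _ ≤ S.card := by exact_mod_cast hcard

end Separated

section Degree

variable {p : ℝ}

theorem sub_eq_sub_of_coe_addCircle_eq {X : Type*} [TopologicalSpace X] [PreconnectedSpace X]
    {a b : X → ℝ} (ha : Continuous a) (hb : Continuous b)
    (h : ∀ x, (a x : AddCircle p) = b x) (x y : X) : a x - b x = a y - b y := by
  have heq : a = fun z => b z + (a y - b y) :=
    (AddCircle.isCoveringMap_coe p).eq_of_comp_eq ha (by fun_prop)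
      (funext fun z => by simp [h]) y (by ring)
  linarith [congrFun heq x]

theorem add_period_sub_eq_of_homotopic {g₀ g₁ : C(AddCircle p, AddCircle p)}
    (hg : g₀.Homotopic g₁) {F₀ F₁ : C(ℝ, ℝ)} (hF₀ : ∀ x : ℝ, (F₀ x : AddCircle p) = g₀ x)
    (hF₁ : ∀ x : ℝ, (F₁ x : AddCircle p) = g₁ x) (x y : ℝ) :
    F₀ (x + p) - F₀ x = F₁ (y + p) - F₁ y := by
  obtain ⟨K⟩ := hg
  let H : C(unitInterval × ℝ, AddCircle p) := ⟨fun q => K (q.1, (q.2 : AddCircle p)), by fun_prop⟩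
  have hH₀ : ∀ x, H (0, x) = (F₀ x : AddCircle p) := fun x => by simp [H, hF₀]
  have hcov := AddCircle.isCoveringMap_coe p
  let L := hcov.liftHomotopy H F₀ hH₀
  have hL : ∀ q, (L q : AddCircle p) = H q := congrFun (hcov.liftHomotopy_lifts H F₀ hH₀)
  have hL₀ : ∀ x, L (0, x) = F₀ x := hcov.liftHomotopy_zero H F₀ hH₀
  have hhomotopy := sub_eq_sub_of_coe_addCircle_eq (p := p)
    (a := fun q : unitInterval × ℝ => L (q.1, q.2 + p)) (b := L) (by fun_prop) (by fun_prop)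
    (fun q => by simp [hL, H]) (0, x) (1, y)
  have hend := sub_eq_sub_of_coe_addCircle_eq (p := p)
    (a := fun z : ℝ => L (1, z)) (b := F₁) (by fun_prop) (by fun_prop)
    (fun z => by simp [hL, H, hF₁]) (y + p) y
  simp only [hL₀] at hhomotopy
  linarith

theorem IsCircleLift.snd_add_one {Θ : Type*} [TopologicalSpace Θ] {r : C(Θ, Θ)}
    {f : C(Θ × UnitAddCircle, Θ × UnitAddCircle)} (hid : IsHomotopicToIdentity r f)
    {F : C(Θ × ℝ, Θ × ℝ)} (hF : IsCircleLift F f) (θ : Θ) (x : ℝ) :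
    (F (θ, x + 1)).2 = (F (θ, x)).2 + 1 := by
  let ι : C(UnitAddCircle, Θ × UnitAddCircle) := ⟨fun φ => (θ, φ), by fun_prop⟩
  have hfibre : (ContinuousMap.snd.comp (f.comp ι)).Homotopic (.id UnitAddCircle) :=
    .comp (.refl ContinuousMap.snd) (.comp hid (.refl ι))
  have hdeg := add_period_sub_eq_of_homotopic hfibre
    (F₀ := ⟨fun x => (F (θ, x)).2, by fun_prop⟩) (F₁ := .id ℝ)
    (fun x => congrArg Prod.snd (hF (θ, x))) (fun _ => rfl) x 0
  simp only [ContinuousMap.coe_mk, ContinuousMap.id_apply] at hdeg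
  linarith

end Degree

section FibreDisplacement

variable {Θ : Type*}

/-- The displacement `G_θ x - x` of a self-map `G` of `Θ × ℝ` at `p = (θ, x)`. -/
def fibreDisplacement (G : Θ × ℝ → Θ × ℝ) (p : Θ × ℝ) : ℝ :=
  (G p).2 - p.2

/-- The largest displacement of `G` in the fibre over `θ`. -/
noncomputable def maxFibreDisplacement (G : Θ × ℝ → Θ × ℝ) (θ : Θ) : ℝ :=
  ⨆ x, fibreDisplacement G (θ, x)

/-- The smallest displacement of `G` in the fibre over `θ`. -/
noncomputable def minFibreDisplacement (G : Θ × ℝ → Θ × ℝ) (θ : Θ) : ℝ :=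
  ⨅ x, fibreDisplacement G (θ, x)

/-- The oscillation of the displacement of `G` in the fibre over `θ`; it measures how far `G`
stretches that fibre. -/
noncomputable def fibreOscillation (G : Θ × ℝ → Θ × ℝ) (θ : Θ) : ℝ :=
  maxFibreDisplacement G θ - minFibreDisplacement G θ

theorem birkhoffSum_fibreDisplacement (G : Θ × ℝ → Θ × ℝ) (n : ℕ) :
    birkhoffSum G (fibreDisplacement G) n = fibreDisplacement G^[n] := by
  ext p
  simp only [birkhoffSum, fibreDisplacement, ← Function.iterate_succ_apply']
  exact Finset.sum_range_sub (fun k => (G^[k] p).2) n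

theorem mem_fibredRotationInterval_iff {G : Θ × ℝ → Θ × ℝ} {ρ : ℝ} :
    ρ ∈ fibredRotationInterval G ↔
      ∃ p, limsup (fun n => birkhoffAverage ℝ G (fibreDisplacement G) n p) atTop = ρ := by
  simp only [fibredRotationInterval, Set.mem_range, birkhoffAverage,
    birkhoffSum_fibreDisplacement, fibreDisplacement, one_div, smul_eq_mul]

end FibreDisplacement

theorem isOpenQuotientMap_circleProj {Θ : Type*} [TopologicalSpace Θ] :
    IsOpenQuotientMap (circleProj : Θ × ℝ → Θ × UnitAddCircle) :=
  IsOpenQuotientMap.id.prodMap QuotientAddGroup.isOpenQuotientMap_mk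

/-- A continuous fibred self-map of `Θ × ℝ` over `R` which commutes with the unit translation in
the fibres: these are the lifts of the fibred self-maps of `Θ × ℝ/ℤ` of fibrewise degree one. -/
structure IsDegreeOneLift {Θ : Type*} [TopologicalSpace Θ] (R : Θ → Θ) (G : Θ × ℝ → Θ × ℝ) :
    Prop where
  continuous : Continuous G
  semiconj_fst : Function.Semiconj Prod.fst G R
  snd_add_one : ∀ θ x, (G (θ, x + 1)).2 = (G (θ, x)).2 + 1

namespace IsDegreeOneLift

open Dynamics
open scoped Uniformity

section Topological

variable {Θ : Type*} [TopologicalSpace Θ] {R : Θ → Θ} {G : Θ × ℝ → Θ × ℝ} {θ : Θ}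

theorem iterate (h : IsDegreeOneLift R G) (n : ℕ) : IsDegreeOneLift R^[n] G^[n] := by
  refine ⟨h.continuous.iterate n, h.semiconj_fst.iterate_right n, fun θ x => ?_⟩
  have hcomm : Function.Semiconj (Prod.map id (· + 1)) G G := fun p =>
    Prod.ext ((h.semiconj_fst p).trans (h.semiconj_fst (p.1, p.2 + 1)).symm)
      (h.snd_add_one p.1 p.2).symm
  exact congrArg Prod.snd (hcomm.iterate_right n (θ, x)).symm

theorem continuous_fibreDisplacement (h : IsDegreeOneLift R G) :
    Continuous (fibreDisplacement G) :=
  h.continuous.snd.sub continuous_snd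

theorem continuous_snd_apply (h : IsDegreeOneLift R G) (θ : Θ) :
    Continuous fun x => (G (θ, x)).2 :=
  h.continuous.snd.comp (.prodMk_right θ)

theorem periodic (h : IsDegreeOneLift R G) (θ : Θ) :
    Function.Periodic (fun x => fibreDisplacement G (θ, x)) 1 := fun x => by
  simp only [fibreDisplacement, h.snd_add_one, add_sub_add_right_eq_sub]

theorem image_fibreDisplacement_Icc (h : IsDegreeOneLift R G) (θ : Θ) :
    (fun x => fibreDisplacement G (θ, x)) '' Set.Icc 0 1 =
      Set.range fun x => fibreDisplacement G (θ, x) := by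
  simpa only [zero_add] using (h.periodic θ).image_Icc one_pos 0

theorem isCompact_range_fibreDisplacement (h : IsDegreeOneLift R G) (θ : Θ) :
    IsCompact (Set.range fun x => fibreDisplacement G (θ, x)) :=
  (h.periodic θ).compact_of_continuous one_ne_zero
    (h.continuous_fibreDisplacement.comp (.prodMk_right θ))

theorem fibreDisplacement_le_maxFibreDisplacement (h : IsDegreeOneLift R G) :
    fibreDisplacement G ≤ maxFibreDisplacement G ∘ Prod.fst :=
  fun p => le_ciSup (h.isCompact_range_fibreDisplacement p.1).bddAbove p.2

theorem minFibreDisplacement_le_fibreDisplacement (h : IsDegreeOneLift R G) :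
    minFibreDisplacement G ∘ Prod.fst ≤ fibreDisplacement G :=
  fun p => ciInf_le (h.isCompact_range_fibreDisplacement p.1).bddBelow p.2

theorem exists_fibreDisplacement_eq_max (h : IsDegreeOneLift R G) (θ : Θ) :
    ∃ x ∈ Set.Icc (0 : ℝ) 1, fibreDisplacement G (θ, x) = maxFibreDisplacement G θ := by
  have hmem : maxFibreDisplacement G θ ∈ Set.range fun x => fibreDisplacement G (θ, x) :=
    (h.isCompact_range_fibreDisplacement θ).sSup_mem (Set.range_nonempty _)
  rwa [← h.image_fibreDisplacement_Icc] at hmem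

theorem exists_fibreDisplacement_eq_min (h : IsDegreeOneLift R G) (θ : Θ) :
    ∃ x ∈ Set.Icc (0 : ℝ) 1, fibreDisplacement G (θ, x) = minFibreDisplacement G θ := by
  have hmem : minFibreDisplacement G θ ∈ Set.range fun x => fibreDisplacement G (θ, x) :=
    (h.isCompact_range_fibreDisplacement θ).sInf_mem (Set.range_nonempty _)
  rwa [← h.image_fibreDisplacement_Icc] at hmem

theorem continuous_maxFibreDisplacement (h : IsDegreeOneLift R G) :
    Continuous (maxFibreDisplacement G) := by
  have hsup := isCompact_Icc.continuous_sSup (K := Set.Icc (0 : ℝ) 1)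
    (f := fun θ x => fibreDisplacement G (θ, x)) h.continuous_fibreDisplacement
  simp only [h.image_fibreDisplacement_Icc] at hsup
  exact hsup

theorem continuous_minFibreDisplacement (h : IsDegreeOneLift R G) :
    Continuous (minFibreDisplacement G) := by
  have hinf := isCompact_Icc.continuous_sInf (K := Set.Icc (0 : ℝ) 1)
    (f := fun θ x => fibreDisplacement G (θ, x)) h.continuous_fibreDisplacement
  simp only [h.image_fibreDisplacement_Icc] at hinf
  exact hinf

theorem continuous_fibreOscillation (h : IsDegreeOneLift R G) :
    Continuous (fibreOscillation G) :=
  h.continuous_maxFibreDisplacement.sub h.continuous_minFibreDisplacement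

theorem exists_Icc_subset_image_Icc (h : IsDegreeOneLift R G) {K : ℝ}
    (hθ : K + 1 ≤ fibreOscillation G θ) :
    ∃ d, Set.Icc d (d + K) ⊆ (fun x => (G (θ, x)).2) '' Set.Icc 0 1 := by
  obtain ⟨x, hx, hmax⟩ := h.exists_fibreDisplacement_eq_max θ
  obtain ⟨y, hy, hmin⟩ := h.exists_fibreDisplacement_eq_min θ
  have hle : (G (θ, y)).2 + K ≤ (G (θ, x)).2 := by
    simp only [fibreOscillation, ← hmax, ← hmin, fibreDisplacement] at hθ
    linarith [hx.1, hy.2]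
  refine ⟨(G (θ, y)).2, ?_⟩
  calc Set.Icc (G (θ, y)).2 ((G (θ, y)).2 + K)
      ⊆ Set.uIcc (G (θ, y)).2 (G (θ, x)).2 :=
        (Set.Icc_subset_Icc_right hle).trans Set.Icc_subset_uIcc
    _ ⊆ (fun x => (G (θ, x)).2) '' Set.uIcc y x :=
        intermediate_value_uIcc (h.continuous_snd_apply θ).continuousOn
    _ ⊆ (fun x => (G (θ, x)).2) '' Set.Icc 0 1 :=
        Set.image_mono (Set.uIcc_subset_Icc hy hx)

theorem exists_subset_Icc_pair (h : IsDegreeOneLift R G) (hθ : 5 ≤ fibreOscillation G θ) :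
    ∃ I ⊆ Set.Icc (0 : ℝ) 1, ∃ J ⊆ Set.Icc (0 : ℝ) 1,
      (∀ s ∈ I, ∀ t ∈ J, 2 ≤ dist (G (θ, s)).2 (G (θ, t)).2) ∧
      (∃ d, Set.Icc d (d + 1) ⊆ (fun x => (G (θ, x)).2) '' I) ∧
      ∃ d, Set.Icc d (d + 1) ⊆ (fun x => (G (θ, x)).2) '' J := by
  obtain ⟨d, hd⟩ := h.exists_Icc_subset_image_Icc (K := 4) (by linarith)
  have hcover : ∀ T ⊆ Set.Icc d (d + 4), T ⊆
      (fun x => (G (θ, x)).2) '' (Set.Icc 0 1 ∩ (fun x => (G (θ, x)).2) ⁻¹' T) := fun T hT => by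
    rw [Set.image_inter_preimage]
    exact Set.subset_inter (hT.trans hd) subset_rfl
  refine ⟨_, Set.inter_subset_left, _, Set.inter_subset_left, ?_,
    ⟨d, hcover _ (Set.Icc_subset_Icc_right (by linarith))⟩,
    ⟨d + 3, hcover _ (Set.Icc_subset_Icc (by linarith) (by linarith))⟩⟩
  rintro s ⟨-, hs⟩ t ⟨-, ht⟩
  rw [dist_comm]
  exact (by linarith [hs.2, ht.1] : 2 ≤ (G (θ, t)).2 - (G (θ, s)).2).trans (le_abs_self _)

theorem fibre_subset_image {g : Θ × UnitAddCircle → Θ × UnitAddCircle} (h : IsDegreeOneLift R G)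
    (hg : Function.Semiconj circleProj G g) {d : ℝ} {I : Set ℝ}
    (hI : Set.Icc d (d + 1) ⊆ (fun x => (G (θ, x)).2) '' I) :
    {R θ} ×ˢ Set.univ ⊆ g '' ((fun x => circleProj (θ, x)) '' I) := by
  rintro ⟨_, φ⟩ ⟨rfl, -⟩
  obtain ⟨y, hy, rfl⟩ : φ ∈ ((↑) : ℝ → UnitAddCircle) '' Set.Icc d (d + 1) := by
    rw [AddCircle.coe_image_Icc_eq]
    trivial
  obtain ⟨x, hx, rfl⟩ := hI hy
  refine ⟨_, ⟨x, hx, rfl⟩, ?_⟩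
  rw [← hg (θ, x)]
  exact Prod.ext (h.semiconj_fst (θ, x)) rfl

theorem exists_comp_circleProj_eq_fibreDisplacement (h : IsDegreeOneLift R G) :
    ∃ φ : C(Θ × UnitAddCircle, ℝ), φ ∘ circleProj = fibreDisplacement G :=
  ⟨⟨fun q => (h.periodic q.1).lift q.2,
    isOpenQuotientMap_circleProj.continuous_comp_iff.1 h.continuous_fibreDisplacement⟩, rfl⟩

end Topological

section CompactSpace

variable {Θ : Type*} [TopologicalSpace Θ] [CompactSpace Θ] {R : Θ → Θ} {G : Θ × ℝ → Θ × ℝ}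

theorem isBounded_range_fibreDisplacement (h : IsDegreeOneLift R G) :
    Bornology.IsBounded (Set.range (fibreDisplacement G)) := by
  obtain ⟨φ, hφ⟩ := h.exists_comp_circleProj_eq_fibreDisplacement
  rw [← hφ]
  exact (isCompact_range φ.continuous).isBounded.subset (Set.range_comp_subset_range _ _)

end CompactSpace

section Uniform

variable {Θ : Type*} [UniformSpace Θ] [CompactSpace Θ] {R : Θ → Θ} {G : Θ × ℝ → Θ × ℝ}

theorem exists_uniformity_dist_lt_two (h : IsDegreeOneLift R G) :
    ∃ V : SetRel (Θ × UnitAddCircle) (Θ × UnitAddCircle),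
      V ∈ 𝓤 (Θ × UnitAddCircle) ∧ V.IsRefl ∧ V.IsSymm ∧
        ∀ θ, ∀ s ∈ Set.Icc (0 : ℝ) 1, ∀ t ∈ Set.Icc (0 : ℝ) 1,
          (circleProj (θ, s), circleProj (θ, t)) ∈ V → dist (G (θ, s)).2 (G (θ, t)).2 < 2 := by
  obtain ⟨φ, hφ⟩ := h.exists_comp_circleProj_eq_fibreDisplacement
  have hφ' : ∀ p, φ (circleProj p) = (G p).2 - p.2 := congrFun hφ
  refine ⟨{q | dist (φ q.1) (φ q.2) < 1},
    (CompactSpace.uniformContinuous_of_continuous φ.continuous)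
      (Metric.dist_mem_uniformity one_pos),
    ⟨fun q => by simp⟩, ⟨fun q q' hq => by simpa [dist_comm] using hq⟩,
    fun θ s hs t ht hst => ?_⟩
  have hdisp : |((G (θ, s)).2 - s) - ((G (θ, t)).2 - t)| < 1 := by
    simpa only [Set.mem_ofPred_eq, hφ', Real.dist_eq] using hst
  rw [abs_lt] at hdisp
  rw [Real.dist_eq, abs_lt]
  constructor <;> linarith [hs.1, hs.2, ht.1, ht.2]

theorem exists_isSeparated_two_pow_visitCount {g : Θ × UnitAddCircle → Θ × UnitAddCircle}
    (h : IsDegreeOneLift R G) (hg : Function.Semiconj circleProj G g) :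
    ∃ V ∈ 𝓤 (Θ × UnitAddCircle), ∀ n θ, ∃ S : Finset (Θ × UnitAddCircle),
      (dynEntourage g V n).IsSeparated S ∧
        2 ^ visitCount R {θ | 5 ≤ fibreOscillation G θ} n θ ≤ S.card := by
  obtain ⟨V, hV, hrefl, hsymm, hdist⟩ := h.exists_uniformity_dist_lt_two
  have hfibre : ∀ (θ : Θ) (I : Set ℝ), (fun x => circleProj (θ, x)) '' I ⊆ {θ} ×ˢ Set.univ := by
    rintro θ I _ ⟨x, -, rfl⟩
    exact ⟨rfl, trivial⟩
  have honto : ∀ θ : Θ, {R θ} ×ˢ Set.univ ⊆ g '' ({θ} ×ˢ Set.univ) := fun θ => by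
    have hIcc := intermediate_value_Icc zero_le_one (h.continuous_snd_apply θ).continuousOn
    rw [← zero_add (1 : ℝ), h.snd_add_one] at hIcc
    exact (h.fibre_subset_image hg hIcc).trans (Set.image_mono (hfibre θ _))
  have hpieces : ∀ θ ∈ {θ | 5 ≤ fibreOscillation G θ},
      ∃ B ⊆ {θ} ×ˢ Set.univ, ∃ C ⊆ {θ} ×ˢ Set.univ, (∀ x ∈ B, ∀ y ∈ C, (x, y) ∉ V) ∧
        {R θ} ×ˢ Set.univ ⊆ g '' B ∧ {R θ} ×ˢ Set.univ ⊆ g '' C := fun θ hθ => by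
    obtain ⟨I, hI, J, hJ, hIJ, ⟨d, hd⟩, d', hd'⟩ := h.exists_subset_Icc_pair hθ
    refine ⟨_, hfibre θ I, _, hfibre θ J, ?_, h.fibre_subset_image hg hd,
      h.fibre_subset_image hg hd'⟩
    rintro _ ⟨s, hs, rfl⟩ _ ⟨t, ht, rfl⟩ hst
    exact (hdist θ s (hI hs) t (hJ ht) hst).not_ge (hIJ s hs t ht)
  refine ⟨V, hV, fun n θ => ?_⟩
  obtain ⟨S, -, hS⟩ := exists_isSeparated_subset_two_pow_visitCount
    (fun θ => (Set.singleton_nonempty θ).prod Set.univ_nonempty) honto hpieces n θ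
  exact ⟨S, hS⟩

end Uniform

end IsDegreeOneLift

section PositiveEntropy

theorem IsUniquelyErgodic.exists_tendsto_birkhoffAverage_fibreOscillation {Θ : Type*}
    [TopologicalSpace Θ] [CompactSpace Θ] [T2Space Θ] [HasOuterApproxClosed Θ]
    [MeasurableSpace Θ] [BorelSpace Θ] {r : C(Θ, Θ)} (hr : IsUniquelyErgodic r)
    {F : Θ × ℝ → Θ × ℝ} (hF : IsDegreeOneLift r F) {a b : ℝ}
    (ha : a ∈ fibredRotationInterval F) (hb : b ∈ fibredRotationInterval F)
    {N : ℕ} (hN : 0 < N) :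
    ∃ c, N * (b - a) ≤ c ∧
      ∀ θ, Tendsto (fun n => birkhoffAverage ℝ r (fibreOscillation F^[N]) n θ) atTop (𝓝 c) := by
  have hFN := hF.iterate N
  obtain ⟨M, hM⟩ : ∃ M, ∀ θ,
      Tendsto (fun n => birkhoffAverage ℝ r (maxFibreDisplacement F^[N]) n θ) atTop (𝓝 M) :=
    hr.exists_tendsto_birkhoffAverage ⟨_, hFN.continuous_maxFibreDisplacement⟩
  obtain ⟨m, hm⟩ : ∃ m, ∀ θ,
      Tendsto (fun n => birkhoffAverage ℝ r (minFibreDisplacement F^[N]) n θ) atTop (𝓝 m) :=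
    hr.exists_tendsto_birkhoffAverage ⟨_, hFN.continuous_minFibreDisplacement⟩
  obtain ⟨p, rfl⟩ := mem_fibredRotationInterval_iff.1 ha
  obtain ⟨q, rfl⟩ := mem_fibredRotationInterval_iff.1 hb
  have hbdd := hF.isBounded_range_fibreDisplacement
  have hle := limsup_birkhoffAverage_le_div (f := F) (x := q) (c := M) hbdd hN
    ((birkhoffSum_fibreDisplacement F N).trans_le hFN.fibreDisplacement_le_maxFibreDisplacement)
    (by simpa only [birkhoffAverage_comp_of_semiconj ℝ hF.semiconj_fst] using hM q.1)
  have hge := div_le_limsup_birkhoffAverage (f := F) (x := p) (c := m) hbdd hN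
    (hFN.minFibreDisplacement_le_fibreDisplacement.trans_eq
      (birkhoffSum_fibreDisplacement F N).symm)
    (by simpa only [birkhoffAverage_comp_of_semiconj ℝ hF.semiconj_fst] using hm p.1)
  refine ⟨M - m, ?_, fun θ => ?_⟩
  · rw [mul_comm, ← le_div_iff₀ (by exact_mod_cast hN), sub_div]
    exact sub_le_sub hle hge
  · refine ((hM θ).sub (hm θ)).congr fun n => ?_
    exact (congrFun (congrFun birkhoffAverage_sub n) θ).symm

theorem topEntropy_pos_of_tendsto_birkhoffAverage_fibreOscillation {Θ : Type*} [UniformSpace Θ]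
    [CompactSpace Θ] {R : Θ → Θ} {F : Θ × ℝ → Θ × ℝ} (hF : IsDegreeOneLift R F)
    {f : Θ × UnitAddCircle → Θ × UnitAddCircle} (hf : Function.Semiconj circleProj F f)
    {N : ℕ} (hN : 0 < N) {c : ℝ} (hc : 5 < c) {θ : Θ}
    (h : Tendsto (fun n => birkhoffAverage ℝ R (fibreOscillation F^[N]) n θ) atTop (𝓝 c)) :
    0 < topEntropy f := by
  have hFN := hF.iterate N
  obtain ⟨b, hb, hbc⟩ := exists_between hc
  obtain ⟨M, hM, hle⟩ : ∃ M > 0, ∀ θ, fibreOscillation F^[N] θ ≤ 5 + M := by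
    obtain ⟨C, hC⟩ := (isCompact_range hFN.continuous_fibreOscillation).bddAbove
    exact ⟨max 1 (C - 5), by positivity, fun θ => by
      linarith [hC ⟨θ, rfl⟩, le_max_right 1 (C - 5)]⟩
  obtain ⟨V, hV, hsep⟩ := hFN.exists_isSeparated_two_pow_visitCount (hf.iterate_right N)
  refine topEntropy_pos_of_eventually_isSeparated_iterate hV hN (c := (b - 5) / M)
    (div_pos (sub_pos.2 hb) hM) ?_
  have hlt : ∀ᶠ n in atTop, b < birkhoffAverage ℝ R (fibreOscillation F^[N]) (N * n) θ :=
    (tendsto_id.const_mul_atTop' hN).eventually (h.eventually (lt_mem_nhds hbc))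
  filter_upwards [hlt] with n hn
  obtain ⟨θ', hθ'⟩ := exists_mul_le_birkhoffSum_iterate hN hn.le
  obtain ⟨S, hS, hcard⟩ := hsep n θ'
  refine ⟨S, _, hS, hcard, ?_⟩
  have hvisit := birkhoffSum_le_mul_add_mul_visitCount
    (P := {θ | 5 ≤ fibreOscillation F^[N] θ}) (fun _ hθ => le_of_not_ge hθ)
    (fun θ _ => hle θ) R^[N] n θ'
  rw [div_mul_eq_mul_div, div_le_iff₀ hM]
  linarith

theorem theoremt_general {Θ : Type*} [UniformSpace Θ] [CompactSpace Θ] [T2Space Θ]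
    [HasOuterApproxClosed Θ] [MeasurableSpace Θ] [BorelSpace Θ] (r : C(Θ, Θ))
    (hr : IsUniquelyErgodic r) (f : C(Θ × UnitAddCircle, Θ × UnitAddCircle))
    (hf : IsForcedCircleMap r f) (hid : IsHomotopicToIdentity r f)
    (F : C(Θ × ℝ, Θ × ℝ)) (hF : IsCircleLift F f)
    (hρ : (fibredRotationInterval F).Nontrivial) :
    0 < topEntropy f := by
  have hlift : IsDegreeOneLift r F :=
    ⟨F.continuous, fun p => (congrArg Prod.fst (hF p)).trans (hf p.1 p.2), hF.snd_add_one hid⟩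
  obtain ⟨a, ha, b, hb, hab⟩ := hρ.exists_lt
  obtain ⟨N, hN⟩ := exists_nat_gt (5 / (b - a))
  have hNab : 5 < N * (b - a) := (div_lt_iff₀ (sub_pos.2 hab)).1 hN
  have hN_pos : 0 < N := by
    exact_mod_cast (div_pos (by norm_num) (sub_pos.2 hab)).trans hN
  obtain ⟨c, hc, htendsto⟩ :=
    hr.exists_tendsto_birkhoffAverage_fibreOscillation hlift ha hb hN_pos
  have ⟨p, _⟩ := mem_fibredRotationInterval_iff.1 ha
  exact topEntropy_pos_of_tendsto_birkhoffAverage_fibreOscillation hlift hF hN_pos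
    (hNab.trans_le hc) (htendsto p.1)

end PositiveEntropy

theorem theoremt {Θ : Type*} [MetricSpace Θ] [CompactSpace Θ] [MeasurableSpace Θ] [BorelSpace Θ]
    (r : C(Θ, Θ)) (hr : IsUniquelyErgodic r)
    (f : C(Θ × UnitAddCircle, Θ × UnitAddCircle))
    (hf : IsForcedCircleMap r f) (hid : IsHomotopicToIdentity r f)
    (F : C(Θ × ℝ, Θ × ℝ)) (hF : IsCircleLift F f)
    (hρ : (interior (fibredRotationInterval F)).Nonempty) :
    0 < topEntropy f := by
  obtain ⟨x, hx⟩ := hρ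
  exact theoremt_general r hr f hf hid F hF
    (infinite_of_mem_nhds x (mem_interior_iff_mem_nhds.1 hx)).nontrivial
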